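/- Let $\mathcal F$ be a finite $w$-set system on a finite ground set $X$, i.e. a family of subsets of $X$, each of size at most $w$. Given a partition $X=X_1\sqcup X_2$ (the elements of $X_1$ are called red, those of $X_2$ blue), a pair $(S_1,S_2)\in\mathcal F^2$ and $j\in\{1,2\}$, with $i=3-j$ the other index, say that $T\in\mathcal F$ mimics $S_j$ if $S_i\cap T=S_i\cap S_j$ and $T\setminus S_j\subseteq X_j$. The pair $(S_1,S_2)$ is called $n$-good if for each $j\in\{1,2\}$ at least $|\mathcal F|/n$ sets $T\in\mathcal F$ mimic $S_j$. For $U\subseteq X$ the link of $\mathcal F$ at $U$ is $\mathcal F_U=\{S\setminus U: S\in\mathcal F,\ U\subseteq S\}$. There is an absolute constant $D>0$ such that for every $\varepsilon>0$ there is $w_0$ such that for all $w\ge w_0$, every finite set $X$ and every $w$-set system $\mathcal F$ on $X$ the following holds. Let $X=X_1\sqcup X_2$ be a random partition, either with each element put into $X_1$ or $X_2$ independently with probability $1/2$, or uniformly random among the partitions with $\bigl||X_1|-|X_2|\bigr|\le 1$. Then, in each of these two models, with probability at least $1-\varepsilon$, all but at most an $\varepsilon$-fraction of the pairs $(S,T)\in\mathcal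 F^2$ with $S\setminus T\subseteq X_1$ and $T\setminus S\subseteq X_2$ have the following two properties: $(S,T)$ is $D^w$-good; and the link $\mathcal F_{S\cap T}$ contains at least $|\mathcal F|/D^w$ sets that are subsets of $X_1$ and at least $|\mathcal F|/D^w$ sets that are subsets of $X_2$. -/

import Mathlib

namespace Inflation

/-- A `w`-set system: a family of sets, each of size at most `w`. -/
def IsSetSystem {X : Type*} (w : ℕ) (F : Finset (Finset X)) : Prop :=
  ∀ S ∈ F, S.card ≤ w

/-- Given a coloring `c` of the ground set with `k` colors and a `k`-tuple `S`, the set `T` mimics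
`S j` with respect to `S`: it meets every other `S i` exactly as `S j` does, and all elements of
`T \ S j` have color `j`. -/
def Mimics {X : Type*} [DecidableEq X] {k : ℕ} (c : X → Fin k) (S : Fin k → Finset X)
    (j : Fin k) (T : Finset X) : Prop :=
  (∀ i, i ≠ j → S i ∩ T = S i ∩ S j) ∧ ∀ x ∈ T \ S j, c x = j

open Classical in
/-- The `k`-tuple `S` is `n`-`j`-bad: fewer than `|F| / n` sets of `F` mimic `S j`. -/
def IsBadAt {X : Type*} [DecidableEq X] {k : ℕ} (F : Finset (Finset X)) (n : ℝ)
    (c : X → Fin k) (S : Fin k → Finset X) (j : Fin k) : Prop :=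
  ((F.filter (fun T => Mimics c S j T)).card : ℝ) < (F.card : ℝ) / n

/-- The `k`-tuple `S` is `n`-good: it is `n`-`j`-bad for no `j`. -/
def IsGood {X : Type*} [DecidableEq X] {k : ℕ} (F : Finset (Finset X)) (n : ℝ)
    (c : X → Fin k) (S : Fin k → Finset X) : Prop :=
  ¬ ∃ j, IsBadAt F n c S j

/-- The link `F_U = {S \ U : S ∈ F, U ⊆ S}`. -/
def link {X : Type*} [DecidableEq X] (F : Finset (Finset X)) (U : Finset X) :
    Finset (Finset X) :=
  (F.filter (fun S => U ⊆ S)).image (fun S => S \ U)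

/-- The sets of a family all of whose elements have color `i`. -/
def monochromatic {X : Type*} {k : ℕ} (F : Finset (Finset X)) (c : X → Fin k) (i : Fin k) :
    Finset (Finset X) :=
  F.filter (fun S => ∀ x ∈ S, c x = i)

/-- The pairs `(S, T)` of sets of `F` with `S \ T` red and `T \ S` blue, where color `0` is red and
color `1` is blue. -/
def redBluePairs {X : Type*} [DecidableEq X] (F : Finset (Finset X)) (c : X → Fin 2) :
    Finset (Finset X × Finset X) :=
  (F ×ˢ F).filter (fun p => (∀ x ∈ p.1 \ p.2, c x = 0) ∧ ∀ x ∈ p.2 \ p.1, c x = 1)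

/-- The pair `(S, T)` is `n`-good, and the link of `F` at `S ∩ T` contains at least `|F| / n` red
sets and at least `|F| / n` blue sets. -/
def IsGoodWithLinks {X : Type*} [DecidableEq X] (F : Finset (Finset X)) (n : ℝ)
    (c : X → Fin 2) (S T : Finset X) : Prop :=
  IsGood F n c ![S, T] ∧
    (F.card : ℝ) / n ≤ ((monochromatic (link F (S ∩ T)) c 0).card : ℝ) ∧
    (F.card : ℝ) / n ≤ ((monochromatic (link F (S ∩ T)) c 1).card : ℝ)

open Classical in
/-- All but at most an `ε`-fraction of the pairs `(S, T)` of sets of `F` with `S \ T` red and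
`T \ S` blue satisfy `IsGoodWithLinks`. -/
def AlmostAllGood {X : Type*} [DecidableEq X] (F : Finset (Finset X)) (n ε : ℝ)
    (c : X → Fin 2) : Prop :=
  (((redBluePairs F c).filter (fun p => ¬ IsGoodWithLinks F n c p.1 p.2)).card : ℝ) ≤
    ε * ((redBluePairs F c).card : ℝ)

/-- The red/blue colorings whose two color classes differ in size by at most one (so they have
equal sizes when the size of the ground set is even). -/
def balancedColorings (X : Type*) [Fintype X] [DecidableEq X] : Finset (X → Fin 2) :=
  Finset.univ.filter (fun c =>
    (Finset.univ.filter (fun x => c x = 0)).card ≤ (Finset.univ.filter (fun x => c x = 1)).card + 1 ∧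
    (Finset.univ.filter (fun x => c x = 1)).card ≤ (Finset.univ.filter (fun x => c x = 0)).card + 1)

open Classical in
/-- The probability of the event `P` for a uniformly random element of the finite set `Ω`. -/
noncomputable def uniformProb {α : Type*} (Ω : Finset α) (P : α → Prop) : ℝ :=
  ((Ω.filter P).card : ℝ) / (Ω.card : ℝ)

end Inflation

/-!
For a coloring `c`, call `(S, T)` a red-blue pair if `S \ T` is red and `T \ S` is blue, and let
`N(c)` be the number of red-blue pairs of `F`. The theorem splits into two bounds.

*Few bad pairs, for every coloring.* If `(S, T)` is a red-blue pair and `U = S ∩ T`, the sets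
mimicking `S` are exactly the `V ∈ F` with `U ⊆ V` and `V \ U` red, and these are counted by the
red sets of the link at `U`; likewise for `T` and blue. So a bad pair has an intersection `U` with
fewer than `|F| / n` red (or blue) extensions. Choosing `T`, then `U ⊆ T`, then `S` among the red
extensions of `U` shows that there are at most `2 |F| ^ 2 2 ^ w / n` bad pairs
(`card_not_isGoodWithLinks_le`).

*Many red-blue pairs, for most colorings.* Extend `N` to a bilinear form `N_R(f, g)` on functions on
the subsets of `U`, where `R` is the set of red elements. The heart of the proof is the
negative-moment bound (`sum_inv_sqrt_redBlueForm_le`), for every `f ≥ 0`,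
`∑ R ⊆ U, N_R(f, f) ^ (-1/2) ≤ 2 ^ |U| / ∑ S ⊆ U, f S / 3 ^ |S|`,
by induction on `U`. Separating an element `a`, write `f₀` and `f₁` for the parts of `f` on sets
avoiding and containing `a`. With `s = N(f₀, f₀) + N(f₁, f₁)`, `p = N(f₁, f₀)`, `q = N(f₀, f₁)`, the
form becomes `s + p` if `a` is red and `s + q` if `a` is blue, while
`s + p + q = N(f₀ + f₁, f₀ + f₁)`. Convexity of `x ^ (-1/2)` replaces the pair `s + p`, `s + q` by
the more spread out pair `s`, `s + p + q`, and both of these are controlled by the induction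
hypothesis, applied to `f₀`, `f₁` and `f₀ + f₁`. Markov's inequality then shows that
`N(c) ≥ |F| ^ 2 / 576 ^ w` except with probability `2 ^ (-w)` for a uniform coloring.

For balanced colorings, let `m = |X|`. If `m < 4 w` then `|F| ≤ 16 ^ w`, and the diagonal pairs
`(S, S)` alone suffice. Otherwise, by averaging, some `V` with `|V| = ⌊m / 2⌋` contains at least
`|F| / 4 ^ w` sets of `F` (`exists_card_eq_half_card_le`), and a balanced coloring induces on `V`
any given coloring with probability at most `4 / 2 ^ |V|` (`card_balancedColorings_fiber_mul_le`), so
the bound for uniform colorings of `V` carries over.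
-/

namespace Inflation

variable {X : Type*}

/-! ### The red-blue form and its negative moment -/

/-- The sum of `f` over the subsets of `U`, where a set `S` is discounted by `3 ^ |S|`. -/
noncomputable def weight (U : Finset X) (f : Finset X → ℝ) : ℝ :=
  ∑ S ∈ U.powerset, f S / 3 ^ S.card

theorem weight_nonneg (U : Finset X) {f : Finset X → ℝ} (hf : ∀ S, 0 ≤ f S) :
    0 ≤ weight U f :=
  Finset.sum_nonneg fun S _ => div_nonneg (hf S) (by positivity)

theorem eq_zero_of_weight_eq_zero {U : Finset X} {f : Finset X → ℝ} (hf : ∀ S, 0 ≤ f S)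
    (h : weight U f = 0) {S : Finset X} (hS : S ∈ U.powerset) : f S = 0 := by
  have h1 := (Finset.sum_eq_zero_iff_of_nonneg fun S _ =>
    div_nonneg (hf S) (by positivity)).1 h S hS
  have h3 : (3 : ℝ) ^ S.card ≠ 0 := by positivity
  simpa [h3] using h1

theorem weight_add (U : Finset X) (f g : Finset X → ℝ) :
    weight U (fun S => f S + g S) = weight U f + weight U g := by
  simp only [weight, ← Finset.sum_add_distrib, add_div]

variable [DecidableEq X]

/-- The sum of `f S * g T` over the pairs of subsets of `U` with `S \ T` red and `T \ S` blue, where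
the elements of `R` are red and all others are blue. -/
noncomputable def redBlueForm (U R : Finset X) (f g : Finset X → ℝ) : ℝ :=
  ∑ S ∈ U.powerset, ∑ T ∈ U.powerset,
    if S \ T ⊆ R ∧ Disjoint (T \ S) R then f S * g T else 0

theorem redBlueForm_nonneg (U R : Finset X) {f g : Finset X → ℝ} (hf : ∀ S, 0 ≤ f S)
    (hg : ∀ S, 0 ≤ g S) : 0 ≤ redBlueForm U R f g := by
  refine Finset.sum_nonneg fun S _ => Finset.sum_nonneg fun T _ => ?_
  split_ifs
  · exact mul_nonneg (hf S) (hg T)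
  · exact le_rfl

/-- The diagonal terms `f S * f S` are always present in the form. -/
theorem redBlueForm_self_pos {U : Finset X} {f : Finset X → ℝ} (hf : ∀ S, 0 ≤ f S)
    (h : 0 < weight U f) (R : Finset X) : 0 < redBlueForm U R f f := by
  obtain ⟨S, hS, hne⟩ := Finset.exists_ne_zero_of_sum_ne_zero h.ne'
  have hpos : 0 < f S := lt_of_le_of_ne (hf S) fun h0 => hne (by simp [← h0])
  have hnn : ∀ S' T : Finset X,
      0 ≤ if S' \ T ⊆ R ∧ Disjoint (T \ S') R then f S' * f T else 0 := by
    intro S' T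
    split_ifs
    · exact mul_nonneg (hf _) (hf _)
    · exact le_rfl
  calc 0 < f S * f S := mul_pos hpos hpos
    _ = if S \ S ⊆ R ∧ Disjoint (S \ S) R then f S * f S else 0 := by simp
    _ ≤ ∑ T ∈ U.powerset, if S \ T ⊆ R ∧ Disjoint (T \ S) R then f S * f T else 0 :=
      Finset.single_le_sum (f := fun T =>
        if S \ T ⊆ R ∧ Disjoint (T \ S) R then f S * f T else 0) (fun T _ => hnn S T) hS
    _ ≤ redBlueForm U R f f :=
      Finset.single_le_sum (f := fun S => ∑ T ∈ U.powerset,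
        if S \ T ⊆ R ∧ Disjoint (T \ S) R then f S * f T else 0)
        (fun S' _ => Finset.sum_nonneg fun T _ => hnn S' T) hS

theorem redBlueForm_congr {U R : Finset X} {f g f' g' : Finset X → ℝ}
    (hf : ∀ S ∈ U.powerset, f S = f' S) (hg : ∀ S ∈ U.powerset, g S = g' S) :
    redBlueForm U R f g = redBlueForm U R f' g' :=
  Finset.sum_congr rfl fun S hS => Finset.sum_congr rfl fun T hT => by rw [hf S hS, hg T hT]

theorem redBlueForm_add_self (U R : Finset X) (f g : Finset X → ℝ) :
    redBlueForm U R (fun S => f S + g S) (fun S => f S + g S) =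
      redBlueForm U R f f + redBlueForm U R g g + redBlueForm U R g f + redBlueForm U R f g := by
  simp only [redBlueForm, ← Finset.sum_add_distrib]
  refine Finset.sum_congr rfl fun S _ => Finset.sum_congr rfl fun T _ => ?_
  split_ifs <;> ring

theorem weight_insert {U : Finset X} {a : X} (ha : a ∉ U) (f : Finset X → ℝ) :
    weight (insert a U) f = weight U f + weight U (fun S => f (insert a S)) / 3 := by
  rw [weight, Finset.sum_powerset_insert ha, weight, weight, Finset.sum_div]
  congr 1
  refine Finset.sum_congr rfl fun S hS => ?_
  rw [Finset.card_insert_of_notMem fun h => ha (Finset.mem_powerset.1 hS h), pow_succ, div_div]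

theorem redBlueForm_insert_blue {U R : Finset X} {a : X} (ha : a ∉ U) (hR : R ⊆ U)
    (f : Finset X → ℝ) :
    redBlueForm (insert a U) R f f = redBlueForm U R f f +
      redBlueForm U R (fun S => f (insert a S)) (fun S => f (insert a S)) +
      redBlueForm U R f (fun S => f (insert a S)) := by
  simp only [redBlueForm, Finset.sum_powerset_insert ha, ← Finset.sum_add_distrib]
  refine Finset.sum_congr rfl fun S hS => Finset.sum_congr rfl fun T hT => ?_
  rw [Finset.mem_powerset] at hS hT
  have h1 : a ∉ S := fun h => ha (hS h)
  have h2 : a ∉ T := fun h => ha (hT h)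
  have h3 : a ∉ R := fun h => ha (hR h)
  have e1 : (S \ insert a T ⊆ R ∧ Disjoint (insert a T \ S) R) ↔
      (S \ T ⊆ R ∧ Disjoint (T \ S) R) := by
    rw [Finset.sdiff_insert_of_notMem h1, Finset.insert_sdiff_of_notMem _ h1,
      Finset.disjoint_insert_left]
    simp [h3]
  have e2 : ¬ (insert a S \ T ⊆ R ∧ Disjoint (T \ insert a S) R) := by
    rw [Finset.insert_sdiff_of_notMem _ h2, Finset.insert_subset_iff]
    simp [h3]
  have e3 : (insert a S \ insert a T ⊆ R ∧ Disjoint (insert a T \ insert a S) R) ↔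
      (S \ T ⊆ R ∧ Disjoint (T \ S) R) := by
    rw [Finset.insert_sdiff_insert, Finset.insert_sdiff_insert, Finset.sdiff_insert_of_notMem h1,
      Finset.sdiff_insert_of_notMem h2]
  simp only [e1, e2, e3, if_false]
  split_ifs <;> ring

theorem redBlueForm_insert_red {U R : Finset X} {a : X} (ha : a ∉ U)
    (f : Finset X → ℝ) :
    redBlueForm (insert a U) (insert a R) f f = redBlueForm U R f f +
      redBlueForm U R (fun S => f (insert a S)) (fun S => f (insert a S)) +
      redBlueForm U R (fun S => f (insert a S)) f := by
  simp only [redBlueForm, Finset.sum_powerset_insert ha, ← Finset.sum_add_distrib]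
  refine Finset.sum_congr rfl fun S hS => Finset.sum_congr rfl fun T hT => ?_
  rw [Finset.mem_powerset] at hS hT
  have h1 : a ∉ S := fun h => ha (hS h)
  have h2 : a ∉ T := fun h => ha (hT h)
  have h4 : a ∉ S \ T := fun h => h1 (Finset.mem_sdiff.1 h).1
  have h5 : a ∉ T \ S := fun h => h2 (Finset.mem_sdiff.1 h).1
  have e0 : (S \ T ⊆ insert a R ∧ Disjoint (T \ S) (insert a R)) ↔
      (S \ T ⊆ R ∧ Disjoint (T \ S) R) := by
    rw [Finset.subset_insert_iff_of_notMem h4, Finset.disjoint_insert_right]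
    simp only [h5, not_false_eq_true, true_and]
  have e1 : ¬ (S \ insert a T ⊆ insert a R ∧ Disjoint (insert a T \ S) (insert a R)) := by
    rw [Finset.insert_sdiff_of_notMem _ h1]
    simp
  have e2 : (insert a S \ T ⊆ insert a R ∧ Disjoint (T \ insert a S) (insert a R)) ↔
      (S \ T ⊆ R ∧ Disjoint (T \ S) R) := by
    rw [Finset.insert_sdiff_of_notMem _ h2, Finset.sdiff_insert_of_notMem h2,
      Finset.insert_subset_iff, ← e0]
    simp
  have e3 : (insert a S \ insert a T ⊆ insert a R ∧
      Disjoint (insert a T \ insert a S) (insert a R)) ↔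
      (S \ T ⊆ R ∧ Disjoint (T \ S) R) := by
    rw [Finset.insert_sdiff_insert, Finset.insert_sdiff_insert, Finset.sdiff_insert_of_notMem h1,
      Finset.sdiff_insert_of_notMem h2, e0]
  simp only [e0, e1, e2, e3, if_false]
  split_ifs <;> ring

/-- Convexity of `x ↦ x ^ (-1/2)`: spreading out two arguments with a fixed sum increases the sum of
the values. -/
theorem inv_sqrt_add_inv_sqrt_le {s p q : ℝ} (hs : 0 < s) (hp : 0 ≤ p) (hq : 0 ≤ q) :
    1 / √(s + p) + 1 / √(s + q) ≤ 1 / √s + 1 / √(s + p + q) := by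
  have ha : 0 < √s := Real.sqrt_pos.2 hs
  have hb : 0 < √(s + p) := Real.sqrt_pos.2 (by linarith)
  have hc : 0 < √(s + q) := Real.sqrt_pos.2 (by linarith)
  have hd : 0 < √(s + p + q) := Real.sqrt_pos.2 (by linarith)
  have ha2 : √s ^ 2 = s := Real.sq_sqrt (by linarith)
  have hb2 : √(s + p) ^ 2 = s + p := Real.sq_sqrt (by linarith)
  have hc2 : √(s + q) ^ 2 = s + q := Real.sq_sqrt (by linarith)
  have hd2 : √(s + p + q) ^ 2 = s + p + q := Real.sq_sqrt (by linarith)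
  generalize √s = a at *
  generalize √(s + p) = b at *
  generalize √(s + q) = c at *
  generalize √(s + p + q) = d at *
  have hprod : a * d ≤ b * c := by
    refine (sq_le_sq₀ (by positivity) (by positivity)).1 ?_
    rw [mul_pow, mul_pow, ha2, hb2, hc2, hd2]
    nlinarith [mul_nonneg hp hq]
  rw [div_add_div _ _ hb.ne' hc.ne', div_add_div _ _ ha.ne' hd.ne',
    div_le_div_iff₀ (by positivity) (by positivity)]
  -- Since `(b + c) ^ 2 = k + 2 * b * c` and `(a + d) ^ 2 = k + 2 * a * d` with the same `k`, the
  -- claim is that `(k + 2 * t) / t ^ 2` is decreasing in `t`.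
  refine (sq_le_sq₀ (by positivity) (by positivity)).1 ?_
  have e1 : (1 * c + b * 1) ^ 2 = 2 * s + p + q + 2 * (b * c) := by linear_combination hb2 + hc2
  have e2 : (1 * d + a * 1) ^ 2 = 2 * s + p + q + 2 * (a * d) := by linear_combination ha2 + hd2
  rw [mul_pow, mul_pow (1 * d + a * 1), e1, e2]
  have hx : 0 < a * d := by positivity
  generalize a * d = x at *
  generalize b * c = y at *
  have : 0 ≤ (y - x) * ((2 * s + p + q) * (x + y) + 2 * (x * y)) := by
    have := hx.trans_le hprod
    exact mul_nonneg (by linarith) (by positivity)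
  linarith [this]

/-- The numerical inequality that makes the induction close; it is where the factor `3` in `weight`
is used. The hypotheses on `m` say that `m ≤ 1 / max A B`. -/
theorem inv_max_add_inv_add_le {A B m : ℝ} (hA : 0 < A) (hB : 0 < B) (h1 : m ≤ 1 / A)
    (h2 : m ≤ 1 / B) : m + 1 / (A + B) ≤ 2 / (A + B / 3) := by
  rcases le_total B A with h | h
  · refine (add_le_add_left h1 _).trans ?_
    rw [div_add_div _ _ hA.ne' (by positivity), div_le_div_iff₀ (by positivity) (by positivity)]
    nlinarith [mul_nonneg hB.le (sub_nonneg.2 h)]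
  · refine (add_le_add_left h2 _).trans ?_
    rw [div_add_div _ _ hB.ne' (by positivity), div_le_div_iff₀ (by positivity) (by positivity)]
    nlinarith [mul_nonneg hB.le (sub_nonneg.2 h), mul_nonneg hA.le (sub_nonneg.2 h)]

/-- The key estimate: over a uniformly random coloring of `U`, the mean of the form to the power
`-1/2` is at most `1 / weight U f`. If `f` vanishes on the subsets of `U`, both sides are `0`. -/
theorem sum_inv_sqrt_redBlueForm_le (U : Finset X) {f : Finset X → ℝ} (hf : ∀ S, 0 ≤ f S) :
    ∑ R ∈ U.powerset, 1 / √(redBlueForm U R f f) ≤ 2 ^ U.card / weight U f := by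
  induction U using Finset.induction_on generalizing f with
  | empty =>
    simp only [redBlueForm, weight, Finset.powerset_empty, Finset.sum_singleton, Finset.sdiff_self,
      Finset.card_empty, Finset.disjoint_empty_left, Finset.empty_subset, and_self, if_true,
      Real.sqrt_mul_self (hf ∅), pow_zero, div_one, le_refl]
  | insert a U ha ih =>
    set g : Finset X → ℝ := fun S => f (insert a S) with hg_def
    have hg : ∀ S, 0 ≤ g S := fun S => hf _
    have hfg : ∀ S, 0 ≤ f S + g S := fun S => add_nonneg (hf S) (hg S)
    rw [Finset.sum_powerset_insert ha, weight_insert ha, ← Finset.sum_add_distrib,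
      Finset.card_insert_of_notMem ha, ← hg_def]
    have hsplit : ∀ R ∈ U.powerset,
        1 / √(redBlueForm (insert a U) R f f) + 1 / √(redBlueForm (insert a U) (insert a R) f f) =
        1 / √(redBlueForm U R f f + redBlueForm U R g g + redBlueForm U R f g) +
        1 / √(redBlueForm U R f f + redBlueForm U R g g + redBlueForm U R g f) := by
      intro R hR
      rw [redBlueForm_insert_blue ha (Finset.mem_powerset.1 hR), redBlueForm_insert_red ha]
    rw [Finset.sum_congr rfl hsplit]
    have zero_left : ∀ (R : Finset X) (h : Finset X → ℝ), redBlueForm U R (fun _ => 0) h = 0 := by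
      intro R h; simp [redBlueForm]
    have zero_right : ∀ (R : Finset X) (h : Finset X → ℝ), redBlueForm U R h (fun _ => 0) = 0 := by
      intro R h; simp [redBlueForm]
    -- If one of the two parts of `f` vanishes, the color of `a` is irrelevant. These cases are
    -- separate because the convexity step needs positive arguments.
    rcases (weight_nonneg U hf).eq_or_lt with hA | hA
    · have hz : ∀ S ∈ U.powerset, f S = 0 := fun S => eq_zero_of_weight_eq_zero hf hA.symm
      have hrw : ∀ R ∈ U.powerset,
          1 / √(redBlueForm U R f f + redBlueForm U R g g + redBlueForm U R f g) +
          1 / √(redBlueForm U R f f + redBlueForm U R g g + redBlueForm U R g f) =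
          2 * (1 / √(redBlueForm U R g g)) := by
        intro R _
        rw [redBlueForm_congr (f := f) (g := f) hz hz,
          redBlueForm_congr (f := f) (g := g) hz fun _ _ => rfl,
          redBlueForm_congr (f := g) (g := f) (fun _ _ => rfl) hz, zero_left, zero_left, zero_right]
        ring_nf
      rw [Finset.sum_congr rfl hrw, ← Finset.mul_sum, ← hA, zero_add]
      have h0 : (0 : ℝ) ≤ 2 ^ U.card / weight U g :=
        div_nonneg (by positivity) (weight_nonneg U hg)
      have e : (2 : ℝ) ^ (U.card + 1) / (weight U g / 3) = 6 * (2 ^ U.card / weight U g) := by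
        rw [pow_succ, div_div_eq_mul_div]; ring
      rw [e]
      linarith [ih hg]
    rcases (weight_nonneg U hg).eq_or_lt with hB | hB
    · have hz : ∀ S ∈ U.powerset, g S = 0 := fun S => eq_zero_of_weight_eq_zero hg hB.symm
      have hrw : ∀ R ∈ U.powerset,
          1 / √(redBlueForm U R f f + redBlueForm U R g g + redBlueForm U R f g) +
          1 / √(redBlueForm U R f f + redBlueForm U R g g + redBlueForm U R g f) =
          2 * (1 / √(redBlueForm U R f f)) := by
        intro R _
        rw [redBlueForm_congr (f := g) (g := g) hz hz,
          redBlueForm_congr (f := g) (g := f) hz fun _ _ => rfl,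
          redBlueForm_congr (f := f) (g := g) (fun _ _ => rfl) hz, zero_left, zero_left, zero_right]
        ring_nf
      rw [Finset.sum_congr rfl hrw, ← Finset.mul_sum, ← hB, zero_div, add_zero, pow_succ,
        mul_comm ((2 : ℝ) ^ U.card) 2, mul_div_assoc]
      linarith [ih hf]
    have hstep : ∀ R ∈ U.powerset,
        1 / √(redBlueForm U R f f + redBlueForm U R g g + redBlueForm U R f g) +
        1 / √(redBlueForm U R f f + redBlueForm U R g g + redBlueForm U R g f) ≤
        1 / √(redBlueForm U R f f + redBlueForm U R g g) +
          1 / √(redBlueForm U R (fun S => f S + g S) (fun S => f S + g S)) := by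
      intro R _
      rw [redBlueForm_add_self, add_comm (1 / √(_ + redBlueForm U R f g))]
      exact inv_sqrt_add_inv_sqrt_le
        (add_pos (redBlueForm_self_pos hf hA R) (redBlueForm_self_pos hg hB R))
        (redBlueForm_nonneg U R hg hf) (redBlueForm_nonneg U R hf hg)
    refine (Finset.sum_le_sum hstep).trans ?_
    rw [Finset.sum_add_distrib]
    have hpow : (0 : ℝ) < 2 ^ U.card := by positivity
    have h1 : (∑ R ∈ U.powerset, 1 / √(redBlueForm U R f f + redBlueForm U R g g)) / 2 ^ U.card ≤
        1 / weight U f := by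
      rw [div_le_iff₀ hpow, one_div_mul_eq_div]
      refine (Finset.sum_le_sum fun R _ => ?_).trans (ih hf)
      exact one_div_le_one_div_of_le (Real.sqrt_pos.2 (redBlueForm_self_pos hf hA R))
        (Real.sqrt_le_sqrt (le_add_of_nonneg_right (redBlueForm_nonneg U R hg hg)))
    have h2 : (∑ R ∈ U.powerset, 1 / √(redBlueForm U R f f + redBlueForm U R g g)) / 2 ^ U.card ≤
        1 / weight U g := by
      rw [div_le_iff₀ hpow, one_div_mul_eq_div]
      refine (Finset.sum_le_sum fun R _ => ?_).trans (ih hg)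
      exact one_div_le_one_div_of_le (Real.sqrt_pos.2 (redBlueForm_self_pos hg hB R))
        (Real.sqrt_le_sqrt (le_add_of_nonneg_left (redBlueForm_nonneg U R hf hf)))
    have h3 := inv_max_add_inv_add_le hA hB h1 h2
    have h4 := ih hfg
    rw [weight_add] at h4
    calc _ ≤ (∑ R ∈ U.powerset, 1 / √(redBlueForm U R f f + redBlueForm U R g g)) +
          2 ^ U.card / (weight U f + weight U g) := add_le_add_right h4 _
      _ = 2 ^ U.card * ((∑ R ∈ U.powerset,
            1 / √(redBlueForm U R f f + redBlueForm U R g g)) / 2 ^ U.card +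
            1 / (weight U f + weight U g)) := by field_simp
      _ ≤ 2 ^ U.card * (2 / (weight U f + weight U g / 3)) :=
          mul_le_mul_of_nonneg_left h3 hpow.le
      _ = 2 ^ (U.card + 1) / (weight U f + weight U g / 3) := by rw [pow_succ]; ring

/-! ### Bad pairs are few for every coloring -/

/-- The sets of `F` that arise from `U` by adding elements of color `i`. -/
def colorExtension (F : Finset (Finset X)) (c : X → Fin 2) (i : Fin 2) (U : Finset X) :
    Finset (Finset X) :=
  F.filter fun T => U ⊆ T ∧ ∀ x ∈ T \ U, c x = i

theorem card_monochromatic_link (F : Finset (Finset X)) (c : X → Fin 2) (i : Fin 2)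
    (U : Finset X) :
    (monochromatic (link F U) c i).card = (colorExtension F c i U).card := by
  have h : monochromatic (link F U) c i = (colorExtension F c i U).image fun S => S \ U := by
    rw [monochromatic, link, Finset.filter_image, Finset.filter_filter, colorExtension]
  rw [h, Finset.card_image_of_injOn]
  intro S hS T hT hST
  have hS' := (Finset.mem_filter.1 hS).2.1
  have hT' := (Finset.mem_filter.1 hT).2.1
  simp only at hST
  rw [← Finset.sdiff_union_of_subset hS', hST, Finset.sdiff_union_of_subset hT']

/-- For a red-blue pair, mimicking depends only on the intersection of the two sets. -/
theorem mimics_iff_of_red_blue {c : X → Fin 2} {S T : Finset X} (hS : ∀ x ∈ S \ T, c x = 0)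
    (hT : ∀ x ∈ T \ S, c x = 1) (j : Fin 2) (V : Finset X) :
    Mimics c ![S, T] j V ↔ S ∩ T ⊆ V ∧ ∀ x ∈ V \ (S ∩ T), c x = j := by
  simp only [Finset.mem_sdiff] at hS hT
  fin_cases j
  · have e : Mimics c ![S, T] 0 V ↔ T ∩ V = T ∩ S ∧ ∀ x ∈ V \ S, c x = 0 := by
      simp [Mimics, Fin.forall_fin_two]
    refine e.trans ⟨fun ⟨h1, h2⟩ => ⟨fun x hx => ?_, fun x hx => ?_⟩,
      fun ⟨h1, h2⟩ => ⟨Finset.ext fun x => ?_, fun x hx => ?_⟩⟩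
    · have hx' : x ∈ T ∩ V := by rw [h1]; rwa [Finset.inter_comm]
      exact (Finset.mem_inter.1 hx').2
    · rw [Finset.mem_sdiff, Finset.mem_inter] at hx
      by_cases hxA : x ∈ S
      · exact hS x ⟨hxA, fun h => hx.2 ⟨hxA, h⟩⟩
      · exact h2 x (Finset.mem_sdiff.2 ⟨hx.1, hxA⟩)
    · rw [Finset.mem_inter, Finset.mem_inter]
      refine and_congr_right fun hxB => ⟨fun hxV => ?_, fun hxA =>
        h1 (Finset.mem_inter.2 ⟨hxA, hxB⟩)⟩
      by_contra hxA
      have hc := h2 x (Finset.mem_sdiff.2 ⟨hxV, fun h => hxA (Finset.mem_inter.1 h).1⟩)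
      rw [hT x ⟨hxB, hxA⟩] at hc
      exact absurd hc (by decide)
    · rw [Finset.mem_sdiff] at hx
      exact h2 x (Finset.mem_sdiff.2 ⟨hx.1, fun h => hx.2 (Finset.mem_inter.1 h).1⟩)
  · have e : Mimics c ![S, T] 1 V ↔ S ∩ V = S ∩ T ∧ ∀ x ∈ V \ T, c x = 1 := by
      simp [Mimics, Fin.forall_fin_two]
    refine e.trans ⟨fun ⟨h1, h2⟩ => ⟨fun x hx => ?_, fun x hx => ?_⟩,
      fun ⟨h1, h2⟩ => ⟨Finset.ext fun x => ?_, fun x hx => ?_⟩⟩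
    · have hx' : x ∈ S ∩ V := by rw [h1]; exact hx
      exact (Finset.mem_inter.1 hx').2
    · rw [Finset.mem_sdiff, Finset.mem_inter] at hx
      by_cases hxA : x ∈ T
      · exact hT x ⟨hxA, fun h => hx.2 ⟨h, hxA⟩⟩
      · exact h2 x (Finset.mem_sdiff.2 ⟨hx.1, hxA⟩)
    · rw [Finset.mem_inter, Finset.mem_inter]
      refine and_congr_right fun hxB => ⟨fun hxV => ?_, fun hxA =>
        h1 (Finset.mem_inter.2 ⟨hxB, hxA⟩)⟩
      by_contra hxA
      have hc := h2 x (Finset.mem_sdiff.2 ⟨hxV, fun h => hxA (Finset.mem_inter.1 h).2⟩)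
      rw [hS x ⟨hxB, hxA⟩] at hc
      exact absurd hc (by decide)
    · rw [Finset.mem_sdiff] at hx
      exact h2 x (Finset.mem_sdiff.2 ⟨hx.1, fun h => hx.2 (Finset.mem_inter.1 h).2⟩)

theorem isGoodWithLinks_of_le_card_colorExtension {F : Finset (Finset X)} {n : ℝ}
    {c : X → Fin 2} {S T : Finset X} (hS : ∀ x ∈ S \ T, c x = 0) (hT : ∀ x ∈ T \ S, c x = 1)
    (h : ∀ i, (F.card : ℝ) / n ≤ ((colorExtension F c i (S ∩ T)).card : ℝ)) :
    IsGoodWithLinks F n c S T := by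
  refine ⟨?_, ?_, ?_⟩
  · rintro ⟨j, hj⟩
    refine (hj.trans_le (h j)).ne (congrArg (fun A : Finset (Finset X) => (A.card : ℝ)) ?_)
    ext V
    simp only [colorExtension, Finset.mem_filter, mimics_iff_of_red_blue hS hT]
  · rw [card_monochromatic_link]; exact h 0
  · rw [card_monochromatic_link]; exact h 1

/-- A set `S` as counted here extends some `U ⊆ T`, in color `i`, where `U` has fewer than `m` such
extensions; there are at most `2 ^ w` choices of `U`. -/
theorem card_filter_inter_le {F : Finset (Finset X)} {w : ℕ} (c : X → Fin 2) (i : Fin 2) {m : ℝ}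
    (hm : 0 ≤ m) {T : Finset X} (hT : T.card ≤ w) :
    ((F.filter fun S => (∀ x ∈ S \ T, c x = i) ∧
      ((colorExtension F c i (S ∩ T)).card : ℝ) < m).card : ℝ) ≤ 2 ^ w * m := by
  have hsub : (F.filter fun S => (∀ x ∈ S \ T, c x = i) ∧
      ((colorExtension F c i (S ∩ T)).card : ℝ) < m) ⊆
      (T.powerset.filter fun U => ((colorExtension F c i U).card : ℝ) < m).biUnion
        (colorExtension F c i) := by
    intro S hS
    obtain ⟨hSF, hS1, hS2⟩ := Finset.mem_filter.1 hS
    refine Finset.mem_biUnion.2 ⟨S ∩ T, Finset.mem_filter.2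
      ⟨Finset.mem_powerset.2 Finset.inter_subset_right, hS2⟩, Finset.mem_filter.2
      ⟨hSF, Finset.inter_subset_left, ?_⟩⟩
    rwa [Finset.sdiff_inter_self_left]
  calc _ ≤ ∑ U ∈ T.powerset.filter fun U => ((colorExtension F c i U).card : ℝ) < m,
        ((colorExtension F c i U).card : ℝ) := by
        exact_mod_cast (Finset.card_le_card hsub).trans Finset.card_biUnion_le
    _ ≤ ∑ U ∈ T.powerset.filter fun U => ((colorExtension F c i U).card : ℝ) < m, m :=
        Finset.sum_le_sum fun U hU => (Finset.mem_filter.1 hU).2.le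
    _ ≤ ∑ U ∈ T.powerset, m :=
        Finset.sum_le_sum_of_subset_of_nonneg (Finset.filter_subset _ _) fun _ _ _ => hm
    _ = 2 ^ T.card * m := by simp
    _ ≤ 2 ^ w * m := by gcongr; norm_num

open Classical in
theorem card_not_isGoodWithLinks_le {F : Finset (Finset X)} {w : ℕ} (hF : IsSetSystem w F) {n : ℝ}
    (hn : 0 ≤ n) (c : X → Fin 2) :
    (((redBluePairs F c).filter fun p => ¬ IsGoodWithLinks F n c p.1 p.2).card : ℝ) ≤
      2 * (F.card * (2 ^ w * (F.card / n))) := by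
  have hm : 0 ≤ (F.card : ℝ) / n := by positivity
  set A : Finset X → Finset (Finset X) := fun T => F.filter fun S => (∀ x ∈ S \ T, c x = 0) ∧
      ((colorExtension F c 0 (S ∩ T)).card : ℝ) < F.card / n with hA
  set B : Finset X → Finset (Finset X) := fun T => F.filter fun S => (∀ x ∈ S \ T, c x = 1) ∧
      ((colorExtension F c 1 (S ∩ T)).card : ℝ) < F.card / n with hB
  have hsub : ((redBluePairs F c).filter fun p => ¬ IsGoodWithLinks F n c p.1 p.2) ⊆
      (F.biUnion fun T => (A T).image fun S => (S, T)) ∪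
      (F.biUnion fun S => (B S).image fun T => (S, T)) := by
    rintro ⟨S, T⟩ h
    simp only [redBluePairs, Finset.mem_filter, Finset.mem_product] at h
    obtain ⟨⟨⟨hSF, hTF⟩, hS, hT⟩, hbad⟩ := h
    have : ¬ ∀ i, (F.card : ℝ) / n ≤ ((colorExtension F c i (S ∩ T)).card : ℝ) := fun h =>
      hbad (isGoodWithLinks_of_le_card_colorExtension hS hT h)
    rw [Fin.forall_fin_two, not_and_or, not_le, not_le] at this
    rw [Finset.mem_union]
    rcases this with h | h
    · exact Or.inl (Finset.mem_biUnion.2 ⟨T, hTF, Finset.mem_image.2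
        ⟨S, Finset.mem_filter.2 ⟨hSF, hS, h⟩, rfl⟩⟩)
    · exact Or.inr (Finset.mem_biUnion.2 ⟨S, hSF, Finset.mem_image.2
        ⟨T, Finset.mem_filter.2 ⟨hTF, hT, by rwa [Finset.inter_comm]⟩, rfl⟩⟩)
  have h1 : (((redBluePairs F c).filter fun p => ¬ IsGoodWithLinks F n c p.1 p.2).card : ℝ) ≤
      ∑ T ∈ F, ((A T).card : ℝ) + ∑ T ∈ F, ((B T).card : ℝ) := by
    have := (Finset.card_le_card hsub).trans ((Finset.card_union_le _ _).trans
      (add_le_add (Finset.card_biUnion_le.trans (Finset.sum_le_sum fun _ _ =>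
        Finset.card_image_le)) (Finset.card_biUnion_le.trans (Finset.sum_le_sum fun _ _ =>
        Finset.card_image_le))))
    exact_mod_cast this
  have h2 : ∑ T ∈ F, ((A T).card : ℝ) ≤ ∑ T ∈ F, 2 ^ w * ((F.card : ℝ) / n) :=
    Finset.sum_le_sum fun T hT => card_filter_inter_le c 0 hm (hF T hT)
  have h3 : ∑ T ∈ F, ((B T).card : ℝ) ≤ ∑ T ∈ F, 2 ^ w * ((F.card : ℝ) / n) :=
    Finset.sum_le_sum fun T hT => card_filter_inter_le c 1 hm (hF T hT)
  rw [Finset.sum_const, nsmul_eq_mul] at h2 h3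
  linarith

/-! ### Middle binomial coefficients -/

theorem two_mul_mul_choose_middle_le (n : ℕ) :
    2 * (n * n.choose (n / 2)) ≤ (n + 1) * (n + 1).choose ((n + 1) / 2) := by
  rcases Nat.even_or_odd' n with ⟨h, rfl | rfl⟩
  · rw [show 2 * h / 2 = h by omega, show (2 * h + 1) / 2 = h by omega]
    have e := Nat.choose_mul_succ_eq (2 * h) h
    rw [show 2 * h + 1 - h = h + 1 by omega] at e
    refine Nat.le_of_mul_le_mul_right (c := h + 1) ?_ h.succ_pos
    rw [mul_assoc (2 * h + 1), ← e]
    nlinarith [Nat.zero_le ((2 * h).choose h)]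
  · rw [show (2 * h + 1) / 2 = h by omega, show (2 * h + 1 + 1) / 2 = h + 1 by omega,
      Nat.choose_succ_succ, Nat.choose_symm_half]
    nlinarith [Nat.zero_le ((2 * h + 1).choose h)]

/-- `n * n.choose (n / 2) / 2 ^ n` is increasing in `n`. -/
theorem two_pow_mul_mul_choose_middle_le (n d : ℕ) :
    2 ^ d * (n * n.choose (n / 2)) ≤ (n + d) * (n + d).choose ((n + d) / 2) := by
  induction d with
  | zero => simp
  | succ d ih =>
    have := two_mul_mul_choose_middle_le (n + d)
    rw [pow_succ, ← add_assoc]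
    linarith

/-- A random half of an `n`-element set contains a given `s`-element set with probability at least
`4 ^ (-s)`. -/
theorem choose_middle_le_four_pow_mul {n s : ℕ} (h : 4 * s ≤ n) :
    n.choose (n / 2) ≤ 4 ^ s * (n - s).choose (n / 2 - s) := by
  induction s with
  | zero => simp
  | succ s ih =>
    refine (ih (by omega)).trans ?_
    obtain ⟨N, hN⟩ : ∃ N, n - s = N + 1 := ⟨n - s - 1, by omega⟩
    obtain ⟨k, hk⟩ : ∃ k, n / 2 - s = k + 1 := ⟨n / 2 - s - 1, by omega⟩
    rw [show n - (s + 1) = N by omega, show n / 2 - (s + 1) = k by omega, hN, hk, pow_succ,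
      mul_assoc]
    refine Nat.mul_le_mul_left _ (Nat.le_of_mul_le_mul_left ?_ N.succ_pos)
    have e := Nat.add_one_mul_choose_eq N k
    calc (N + 1) * (N + 1).choose (k + 1) ≤ (4 * (k + 1)) * (N + 1).choose (k + 1) :=
          Nat.mul_le_mul_right _ (by omega)
      _ = (N + 1) * (4 * N.choose k) := by linarith

variable [Fintype X]

/-! ### Restriction to half of the ground set -/

/-- Averaging over all halves `V` of the ground set finds one that contains many sets of `F`. -/
theorem exists_card_eq_half_card_le {F : Finset (Finset X)} {w : ℕ} (hF : IsSetSystem w F)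
    (hw : 4 * w ≤ Fintype.card X) :
    ∃ V : Finset X, V.card = Fintype.card X / 2 ∧
      F.card ≤ 4 ^ w * (F.filter fun S => S ⊆ V).card := by
  set n := Fintype.card X with hn
  have hne : ((Finset.univ : Finset X).powersetCard (n / 2)).Nonempty :=
    Finset.powersetCard_nonempty.2 (by rw [Finset.card_univ]; omega)
  have hsum : ∑ _V ∈ (Finset.univ : Finset X).powersetCard (n / 2), F.card ≤
      ∑ V ∈ (Finset.univ : Finset X).powersetCard (n / 2),
        4 ^ w * (F.filter fun S => S ⊆ V).card := by
    have hswap : ∑ V ∈ (Finset.univ : Finset X).powersetCard (n / 2),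
        (F.filter fun S => S ⊆ V).card =
        ∑ S ∈ F, (((Finset.univ : Finset X).powersetCard (n / 2)).filter fun V => S ⊆ V).card := by
      simp only [Finset.card_filter]
      exact Finset.sum_comm
    have hS : ∀ S ∈ F, n.choose (n / 2) ≤ 4 ^ w *
        (((Finset.univ : Finset X).powersetCard (n / 2)).filter fun V => S ⊆ V).card := by
      intro S hS
      have hSw := hF S hS
      rw [Finset.card_filter_powersetCard_subset _ _ _ (Finset.subset_univ S) (by omega),
        Finset.card_univ]
      refine (choose_middle_le_four_pow_mul (s := S.card) (by omega)).trans ?_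
      exact Nat.mul_le_mul_right _ (Nat.pow_le_pow_right (by norm_num) hSw)
    calc ∑ _V ∈ (Finset.univ : Finset X).powersetCard (n / 2), F.card
        = ∑ _S ∈ F, n.choose (n / 2) := by
          rw [Finset.sum_const, Finset.sum_const, Finset.card_powersetCard, Finset.card_univ,
            smul_eq_mul, smul_eq_mul, mul_comm]
      _ ≤ _ := Finset.sum_le_sum hS
      _ = _ := by rw [← Finset.mul_sum, ← hswap, Finset.mul_sum]
  obtain ⟨V, hV, h⟩ := Finset.exists_le_of_sum_le hne hsum
  exact ⟨V, (Finset.mem_powersetCard.1 hV).2, h⟩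

/-! ### Colorings and their red sets -/

/-- The set of red elements of a coloring; color `0` is red. -/
def redSet (c : X → Fin 2) : Finset X := Finset.univ.filter fun x => c x = 0

omit [DecidableEq X] in
theorem mem_redSet {c : X → Fin 2} {x : X} : x ∈ redSet c ↔ c x = 0 := by simp [redSet]

omit [DecidableEq X] in
theorem redSet_injective : Function.Injective (redSet (X := X)) := by
  intro c d h
  funext x
  have hx : c x = 0 ↔ d x = 0 := by rw [← mem_redSet, h, mem_redSet]
  omega

theorem mem_balancedColorings_iff {c : X → Fin 2} :
    c ∈ balancedColorings X ↔ (redSet c).card = Fintype.card X / 2 ∨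
      (redSet c).card = Fintype.card X - Fintype.card X / 2 := by
  have h1 : (Finset.univ.filter fun x => c x = 1) = (redSet c)ᶜ := by
    ext x
    rw [Finset.mem_compl, mem_redSet, Finset.mem_filter]
    simp only [Finset.mem_univ, true_and]
    omega
  have h2 := Finset.card_compl_add_card (redSet c)
  rw [balancedColorings, Finset.mem_filter, h1]
  change _ ∧ (redSet c).card ≤ _ ∧ _ ≤ (redSet c).card + 1 ↔ _
  simp only [Finset.mem_univ, true_and]
  omega

theorem choose_middle_le_card_balancedColorings :
    (Fintype.card X).choose (Fintype.card X / 2) ≤ (balancedColorings X).card := by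
  rw [← Finset.card_univ, ← Finset.card_powersetCard]
  refine (Finset.card_le_card fun R hR => ?_).trans
    (Finset.card_image_le (s := balancedColorings X) (f := redSet))
  have hred : redSet (fun x => if x ∈ R then (0 : Fin 2) else 1) = R := by
    ext x
    rw [mem_redSet]
    split_ifs with h <;> simp [h]
  refine Finset.mem_image.2 ⟨_, mem_balancedColorings_iff.2 (Or.inl ?_), hred⟩
  rw [hred, (Finset.mem_powersetCard.1 hR).2, Finset.card_univ]

/-- The red elements outside `V` determine a balanced coloring with given red elements in `V`, and
their number takes at most two values. -/
theorem card_balancedColorings_fiber_le (V R : Finset X) :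
    ((balancedColorings X).filter fun c => redSet c ∩ V = R).card ≤
      2 * (Fintype.card X - V.card).choose ((Fintype.card X - V.card) / 2) := by
  set n := Fintype.card X with hn
  have hinj : Set.InjOn (fun c => redSet c \ V)
      ((balancedColorings X).filter fun c => redSet c ∩ V = R : Finset (X → Fin 2)) := by
    intro c hc d hd h
    have hc' := (Finset.mem_filter.1 hc).2
    have hd' := (Finset.mem_filter.1 hd).2
    refine redSet_injective ?_
    simp only at h
    rw [← Finset.sdiff_union_inter (redSet c) V, h, hc', ← hd', Finset.sdiff_union_inter]
  have hmaps : ∀ c ∈ (balancedColorings X).filter fun c => redSet c ∩ V = R,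
      redSet c \ V ∈ Vᶜ.powersetCard (n / 2 - R.card) ∪ Vᶜ.powersetCard (n - n / 2 - R.card) := by
    intro c hc
    obtain ⟨hc1, hc2⟩ := Finset.mem_filter.1 hc
    have hcard := Finset.card_sdiff_add_card_inter (redSet c) V
    rw [hc2] at hcard
    have hsub : redSet c \ V ⊆ Vᶜ := fun x hx =>
      Finset.mem_compl.2 (Finset.mem_sdiff.1 hx).2
    rw [Finset.mem_union, Finset.mem_powersetCard, Finset.mem_powersetCard]
    rcases mem_balancedColorings_iff.1 hc1 with h | h
    · exact Or.inl ⟨hsub, by omega⟩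
    · exact Or.inr ⟨hsub, by omega⟩
  refine (Finset.card_le_card_of_injOn _ hmaps hinj).trans ((Finset.card_union_le _ _).trans ?_)
  rw [Finset.card_powersetCard, Finset.card_powersetCard, Finset.card_compl, two_mul]
  exact add_le_add (Nat.choose_le_middle _ _) (Nat.choose_le_middle _ _)

/-- A random balanced coloring induces each coloring of a half `V` of the ground set with
probability at most `4 / 2 ^ |V|`. -/
theorem card_balancedColorings_fiber_mul_le {V : Finset X} (hV : V.card = Fintype.card X / 2)
    (hX : 0 < Fintype.card X) :
    2 * (Fintype.card X - V.card).choose ((Fintype.card X - V.card) / 2) * 2 ^ V.card ≤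
      4 * (balancedColorings X).card := by
  have h := two_pow_mul_mul_choose_middle_le (Fintype.card X - V.card) V.card
  rw [Nat.sub_add_cancel (by omega)] at h
  refine le_trans ?_ (Nat.mul_le_mul_left 4 choose_middle_le_card_balancedColorings)
  refine Nat.le_of_mul_le_mul_left ?_ hX
  generalize (Fintype.card X).choose (Fintype.card X / 2) = M at *
  generalize (Fintype.card X - V.card).choose ((Fintype.card X - V.card) / 2) = L at *
  calc Fintype.card X * (2 * L * 2 ^ V.card)
      ≤ (2 * (Fintype.card X - V.card)) * (2 * L * 2 ^ V.card) :=
        Nat.mul_le_mul_right _ (by omega)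
    _ = 4 * (2 ^ V.card * ((Fintype.card X - V.card) * L)) := by ring
    _ ≤ 4 * (Fintype.card X * M) := Nat.mul_le_mul_left 4 h
    _ = Fintype.card X * (4 * M) := by ring

/-- Transfer from a family `Ω` of colorings of `X` to uniform colorings of `V`: if every coloring
of `V` has at most `L` extensions in `Ω`, an event determined by the colors of `V` loses only a
factor `L`. -/
theorem card_filter_inter_redSet_le {Ω : Finset (X → Fin 2)} {V : Finset X} {L : ℕ}
    (hL : ∀ R, (Ω.filter fun c => redSet c ∩ V = R).card ≤ L) (P : Finset X → Prop)
    [DecidablePred P] :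
    (Ω.filter fun c => P (redSet c ∩ V)).card ≤ L * (V.powerset.filter P).card := by
  refine Finset.card_le_mul_card_image_of_maps_to (f := fun c => redSet c ∩ V) (fun c hc => ?_) L
    fun R _ => (Finset.card_le_card ?_).trans (hL R)
  · exact Finset.mem_filter.2 ⟨Finset.mem_powerset.2 Finset.inter_subset_right,
      (Finset.mem_filter.1 hc).2⟩
  · exact Finset.filter_subset_filter _ (Finset.filter_subset _ _)

/-! ### Red-blue pairs are many for most colorings -/

omit [Fintype X] in
theorem mem_redBluePairs {F : Finset (Finset X)} {c : X → Fin 2} {p : Finset X × Finset X} :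
    p ∈ redBluePairs F c ↔ (p.1 ∈ F ∧ p.2 ∈ F) ∧ (∀ x ∈ p.1 \ p.2, c x = 0) ∧
      ∀ x ∈ p.2 \ p.1, c x = 1 := by
  rw [redBluePairs, Finset.mem_filter, Finset.mem_product]

theorem redBlueForm_le_card_redBluePairs (F : Finset (Finset X)) (V : Finset X) (c : X → Fin 2) :
    redBlueForm V (redSet c ∩ V) (fun S => if S ∈ F then 1 else 0)
      (fun S => if S ∈ F then 1 else 0) ≤ ((redBluePairs F c).card : ℝ) := by
  have h : ∀ p : Finset X × Finset X,
      (if p.1 \ p.2 ⊆ redSet c ∩ V ∧ Disjoint (p.2 \ p.1) (redSet c ∩ V) then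
        (if p.1 ∈ F then (1 : ℝ) else 0) * (if p.2 ∈ F then 1 else 0) else 0) =
      if (p.1 \ p.2 ⊆ redSet c ∩ V ∧ Disjoint (p.2 \ p.1) (redSet c ∩ V)) ∧ p.1 ∈ F ∧ p.2 ∈ F
        then 1 else 0 := by
    intro p
    rw [ite_zero_mul_ite_zero, one_mul, ite_and (_ ∧ _)]
  rw [redBlueForm, ← Finset.sum_product', Finset.sum_congr rfl fun p _ => h p, Finset.sum_boole,
    Nat.cast_le]
  refine Finset.card_le_card fun p hp => ?_
  simp only [Finset.mem_filter, Finset.mem_product, Finset.mem_powerset] at hp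
  obtain ⟨⟨-, hV⟩, ⟨h1, h2⟩, h3, h4⟩ := hp
  refine mem_redBluePairs.2 ⟨⟨h3, h4⟩, fun x hx => ?_, fun x hx => ?_⟩
  · exact mem_redSet.1 (Finset.mem_inter.1 (h1 hx)).1
  · have hx' := Finset.disjoint_left.1 h2 hx
    rw [Finset.mem_inter, mem_redSet, not_and] at hx'
    have : c x ≠ 0 := fun h0 => hx' h0 (hV (Finset.mem_sdiff.1 hx).1)
    omega

omit [Fintype X] in
theorem card_div_le_weight {F : Finset (Finset X)} {w : ℕ} (hF : IsSetSystem w F)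
    (V : Finset X) :
    ((F.filter fun S => S ⊆ V).card : ℝ) / 3 ^ w ≤ weight V fun S => if S ∈ F then 1 else 0 := by
  have hnn : ∀ S : Finset X, (0 : ℝ) ≤ (if S ∈ F then 1 else 0) / 3 ^ S.card := by
    intro S; split_ifs <;> positivity
  calc ((F.filter fun S => S ⊆ V).card : ℝ) / 3 ^ w
      = ∑ S ∈ F.filter fun S => S ⊆ V, (1 : ℝ) / 3 ^ w := by
        rw [Finset.sum_const, nsmul_eq_mul, mul_one_div]
    _ ≤ ∑ S ∈ F.filter fun S => S ⊆ V, (if S ∈ F then (1 : ℝ) else 0) / 3 ^ S.card := by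
        refine Finset.sum_le_sum fun S hS => ?_
        have hSF := (Finset.mem_filter.1 hS).1
        rw [if_pos hSF]
        gcongr
        · norm_num
        · exact hF S hSF
    _ ≤ weight V fun S => if S ∈ F then 1 else 0 :=
        Finset.sum_le_sum_of_subset_of_nonneg
          (fun S hS => Finset.mem_powerset.2 (Finset.mem_filter.1 hS).2) fun S _ _ => hnn S

omit [Fintype X] in
/-- Markov's inequality for the form to the power `-1/2`. -/
theorem card_filter_redBlueForm_lt_le (U : Finset X) {f : Finset X → ℝ} (hf : ∀ S, 0 ≤ f S)
    (hU : 0 < weight U f) {s : ℝ} (hs : 0 < s) :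
    ((U.powerset.filter fun R => redBlueForm U R f f < s ^ 2).card : ℝ) ≤
      2 ^ U.card * s / weight U f := by
  have h : ((U.powerset.filter fun R => redBlueForm U R f f < s ^ 2).card : ℝ) * (1 / s) ≤
      2 ^ U.card / weight U f := by
    rw [← nsmul_eq_mul, ← Finset.sum_const]
    refine le_trans ?_ (sum_inv_sqrt_redBlueForm_le U hf)
    refine (Finset.sum_le_sum fun R hR => ?_).trans
      (Finset.sum_le_sum_of_subset_of_nonneg (Finset.filter_subset _ _) fun R _ _ => by positivity)
    refine one_div_le_one_div_of_le (Real.sqrt_pos.2 (redBlueForm_self_pos hf hU R)) ?_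
    exact Real.sqrt_le_iff.2 ⟨hs.le, (Finset.mem_filter.1 hR).2.le⟩
  rw [mul_one_div, div_le_iff₀ hs] at h
  refine h.trans_eq (by ring)

/-- If the random coloring `c ∈ Ω` has density at most `K` on `V` with respect to the uniform
coloring of `V`, and `V` contains a `4 ^ (-w)` fraction of `F`, then there are at least
`(|F| / 24 ^ w) ^ 2` red-blue pairs except with probability `K / 2 ^ w`. Here `24 = 2 * 4 * 3`,
where `4` pays for restricting to `V`, `3` for the weights, and `2` is the gain. -/
theorem card_few_redBluePairs_le {F : Finset (Finset X)} {w : ℕ} (hF : IsSetSystem w F)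
    (hne : F.Nonempty) {V : Finset X} (hV : F.card ≤ 4 ^ w * (F.filter fun S => S ⊆ V).card)
    {Ω : Finset (X → Fin 2)} {L : ℕ}
    (hL : ∀ R, (Ω.filter fun c => redSet c ∩ V = R).card ≤ L) {K : ℕ}
    (hK : L * 2 ^ V.card ≤ K * Ω.card) :
    ((Ω.filter fun c => ((redBluePairs F c).card : ℝ) < (F.card / 24 ^ w) ^ 2).card : ℝ) ≤
      K / 2 ^ w * Ω.card := by
  set f : Finset X → ℝ := fun S => if S ∈ F then 1 else 0 with hf_def
  have hf : ∀ S, 0 ≤ f S := by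
    intro S; simp only [hf_def]; split_ifs <;> norm_num
  have hFpos : (0 : ℝ) < F.card := by exact_mod_cast hne.card_pos
  have hs : (0 : ℝ) < F.card / 24 ^ w := by positivity
  have hweight : (F.card : ℝ) / 12 ^ w ≤ weight V f := by
    refine le_trans ?_ (card_div_le_weight hF V)
    have hV' : (F.card : ℝ) ≤ 4 ^ w * (F.filter fun S => S ⊆ V).card := by exact_mod_cast hV
    rw [show (12 : ℝ) = 4 * 3 by norm_num, mul_pow, ← div_div]
    gcongr
    rw [div_le_iff₀ (by positivity)]
    linarith
  have hwpos : 0 < weight V f := lt_of_lt_of_le (by positivity) hweight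
  have h1 : ((Ω.filter fun c => ((redBluePairs F c).card : ℝ) < (F.card / 24 ^ w) ^ 2).card : ℝ) ≤
      L * (V.powerset.filter fun R => redBlueForm V R f f < (F.card / 24 ^ w) ^ 2).card := by
    rw [← Nat.cast_mul, Nat.cast_le]
    refine le_trans ?_ (card_filter_inter_redSet_le hL _)
    refine Finset.card_le_card (Finset.monotone_filter_right _ fun c _ hc => ?_)
    exact (redBlueForm_le_card_redBluePairs F V c).trans_lt hc
  have h2 : 2 ^ V.card * ((F.card : ℝ) / 24 ^ w) / weight V f ≤ 2 ^ V.card / 2 ^ w := by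
    rw [div_le_iff₀ hwpos]
    refine le_trans (le_of_eq ?_) (mul_le_mul_of_nonneg_left hweight (by positivity))
    rw [show (24 : ℝ) = 2 * 12 by norm_num, mul_pow]
    field_simp
  have h3 := (card_filter_redBlueForm_lt_le V hf hwpos hs).trans h2
  have hK' : (L : ℝ) * 2 ^ V.card ≤ K * Ω.card := by exact_mod_cast hK
  calc _ ≤ (L : ℝ) * (2 ^ V.card / 2 ^ w) := h1.trans (mul_le_mul_of_nonneg_left h3 (by positivity))
    _ = L * 2 ^ V.card / 2 ^ w := by ring
    _ ≤ K * Ω.card / 2 ^ w := by gcongr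
    _ = K / 2 ^ w * Ω.card := by ring

/-! ### From many red-blue pairs to almost all of them being good -/

omit [Fintype X] in
/-- The bad pairs are outnumbered because `2304 = 2 * 2 * 24 ^ 2`, with one factor `2` for the
number of subsets of a `w`-set and one to spare. -/
theorem almostAllGood_of_le_card_redBluePairs {F : Finset (Finset X)} {w : ℕ}
    (hF : IsSetSystem w F) {ε : ℝ} (hε : 2 / 2 ^ w ≤ ε) {c : X → Fin 2}
    (h : ((F.card : ℝ) / 24 ^ w) ^ 2 ≤ (redBluePairs F c).card) :
    AlmostAllGood F (2304 ^ w) ε c := by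
  refine (card_not_isGoodWithLinks_le hF (by positivity) c).trans ?_
  have hε0 : 0 ≤ ε := le_trans (by positivity) hε
  refine le_trans (le_of_eq ?_) (mul_le_mul hε h (by positivity) hε0)
  rw [show (2304 : ℝ) = 2 * 2 * 24 * 24 by norm_num, mul_pow, mul_pow, mul_pow]
  field_simp

omit [Fintype X] in
theorem card_le_card_redBluePairs (F : Finset (Finset X)) (c : X → Fin 2) :
    F.card ≤ (redBluePairs F c).card := by
  refine Finset.card_le_card_of_injOn (fun S => (S, S)) (fun S hS => ?_)
    fun S _ T _ h => (Prod.mk.inj h).1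
  exact Finset.mem_coe.2 (mem_redBluePairs.2 ⟨⟨hS, hS⟩, by simp, by simp⟩)

/-- On a small ground set `F` is so small that the pairs `(S, S)` are enough. -/
theorem almostAllGood_of_card_lt {F : Finset (Finset X)} {w : ℕ}
    (hF : IsSetSystem w F) {ε : ℝ} (hε : 2 / 2 ^ w ≤ ε) (hX : Fintype.card X < 4 * w)
    (c : X → Fin 2) : AlmostAllGood F (2304 ^ w) ε c := by
  refine almostAllGood_of_le_card_redBluePairs hF hε ?_
  refine le_trans ?_ (Nat.cast_le.2 (card_le_card_redBluePairs F c))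
  have h1 : F.card ≤ 2 ^ (4 * w) := by
    refine F.card_le_univ.trans ?_
    rw [Fintype.card_finset]
    exact Nat.pow_le_pow_right (by norm_num) hX.le
  have h2 : (F.card : ℝ) ≤ (24 ^ w) ^ 2 := by
    calc (F.card : ℝ) ≤ 2 ^ (4 * w) := by exact_mod_cast h1
      _ = 16 ^ w := by rw [pow_mul]; norm_num
      _ ≤ 576 ^ w := by gcongr; norm_num
      _ = (24 ^ w) ^ 2 := by rw [← pow_mul, mul_comm, pow_mul]; norm_num
  rw [div_pow, div_le_iff₀ (by positivity), sq]
  exact mul_le_mul_of_nonneg_left h2 (by positivity)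

open Classical in
theorem one_sub_le_uniformProb {α : Type*} {Ω : Finset α} (hΩ : Ω.Nonempty) {P : α → Prop} {ε : ℝ}
    (h : ((Ω.filter fun a => ¬ P a).card : ℝ) ≤ ε * Ω.card) : 1 - ε ≤ uniformProb Ω P := by
  have hpos : (0 : ℝ) < Ω.card := by exact_mod_cast hΩ.card_pos
  rw [uniformProb, le_div_iff₀ hpos]
  have e : ((Ω.filter P).card : ℝ) + (Ω.filter fun a => ¬ P a).card = Ω.card := by
    exact_mod_cast Finset.card_filter_add_card_filter_not (s := Ω) P
  linarith

theorem one_sub_le_uniformProb_almostAllGood {F : Finset (Finset X)} {w : ℕ}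
    (hF : IsSetSystem w F) {ε : ℝ} {V : Finset X}
    (hV : F.card ≤ 4 ^ w * (F.filter fun S => S ⊆ V).card)
    {Ω : Finset (X → Fin 2)} (hΩ : Ω.Nonempty) {L : ℕ}
    (hL : ∀ R, (Ω.filter fun c => redSet c ∩ V = R).card ≤ L)
    (hK : L * 2 ^ V.card ≤ 4 * Ω.card) (hε : 4 / 2 ^ w ≤ ε) :
    1 - ε ≤ uniformProb Ω fun c => AlmostAllGood F (2304 ^ w) ε c := by
  classical
  have hε2 : 2 / 2 ^ w ≤ ε := le_trans (by gcongr; norm_num) hε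
  refine one_sub_le_uniformProb hΩ ?_
  rcases F.eq_empty_or_nonempty with rfl | hne
  · have hgood : ∀ c : X → Fin 2, AlmostAllGood ∅ (2304 ^ w) ε c := fun c =>
      almostAllGood_of_le_card_redBluePairs hF hε2 (by simp)
    simp only [hgood, not_true_eq_false, Finset.filter_false, Finset.card_empty, Nat.cast_zero]
    exact mul_nonneg (le_trans (by positivity) hε) (by positivity)
  · calc _ ≤ ((Ω.filter fun c =>
          ((redBluePairs F c).card : ℝ) < (F.card / 24 ^ w) ^ 2).card : ℝ) := by
          rw [Nat.cast_le]
          refine Finset.card_le_card (Finset.monotone_filter_right _ fun c _ hc => ?_)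
          by_contra hlt
          exact hc (almostAllGood_of_le_card_redBluePairs hF hε2 (not_lt.1 hlt))
      _ ≤ (4 : ℕ) / 2 ^ w * Ω.card := card_few_redBluePairs_le hF hne hV hL hK
      _ ≤ ε * Ω.card := by push_cast; gcongr

end Inflation

theorem mainTheorem7 :
    ∃ D : ℝ, 0 < D ∧ ∀ ε : ℝ, 0 < ε → ∃ w₀ : ℕ, ∀ w : ℕ, w₀ ≤ w →
      ∀ (X : Type*) [Fintype X] [DecidableEq X] (F : Finset (Finset X)),
        Inflation.IsSetSystem w F →
          1 - ε ≤ Inflation.uniformProb (Finset.univ : Finset (X → Fin 2))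
              (fun c => Inflation.AlmostAllGood F (D ^ w) ε c) ∧
          1 - ε ≤ Inflation.uniformProb (Inflation.balancedColorings X)
              (fun c => Inflation.AlmostAllGood F (D ^ w) ε c) := by
  open Inflation in
  refine ⟨2304, by norm_num, fun ε hε => ?_⟩
  obtain ⟨k, hk⟩ := exists_pow_lt_of_lt_one (show 0 < ε / 4 by positivity)
    (show (1 / 2 : ℝ) < 1 by norm_num)
  refine ⟨k + 1, fun w hw X _ _ F hF => ?_⟩
  have hεw : 4 / 2 ^ w ≤ ε := by
    have h1 : (1 / 2 : ℝ) ^ w ≤ (1 / 2) ^ k :=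
      pow_le_pow_of_le_one (by norm_num) (by norm_num) (by omega)
    rw [div_pow, one_pow] at h1
    rw [div_eq_mul_one_div]
    linarith
  constructor
  -- Uniform colorings: here `V` is the whole ground set, and the red set determines the coloring.
  · refine one_sub_le_uniformProb_almostAllGood hF (V := Finset.univ) (L := 1) ?_
      Finset.univ_nonempty (fun R => ?_) ?_ hεw
    · simpa using Nat.le_mul_of_pos_left F.card (show 0 < 4 ^ w by positivity)
    · refine Finset.card_le_one.2 fun c hc d hd => redSet_injective ?_
      have hc' := (Finset.mem_filter.1 hc).2
      have hd' := (Finset.mem_filter.1 hd).2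
      rw [Finset.inter_univ] at hc' hd'
      rw [hc', hd']
    · rw [Finset.card_univ, Finset.card_univ, Fintype.card_fun, Fintype.card_fin]
      omega
  · have hpos : 0 < (balancedColorings X).card :=
      lt_of_lt_of_le (Nat.choose_pos (Nat.div_le_self _ _)) choose_middle_le_card_balancedColorings
    rcases lt_or_ge (Fintype.card X) (4 * w) with hX | hX
    · refine one_sub_le_uniformProb (Finset.card_pos.1 hpos) ?_
      have hgood : ∀ c : X → Fin 2, AlmostAllGood F (2304 ^ w) ε c :=
        almostAllGood_of_card_lt hF (le_trans (by gcongr; norm_num) hεw) hX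
      simp only [hgood, not_true_eq_false, Finset.filter_false, Finset.card_empty, Nat.cast_zero]
      positivity
    · obtain ⟨V, hVcard, hV⟩ := exists_card_eq_half_card_le hF hX
      exact one_sub_le_uniformProb_almostAllGood hF hV (Finset.card_pos.1 hpos)
        (card_balancedColorings_fiber_le V) (card_balancedColorings_fiber_mul_le hVcard (by omega))
        hεw
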